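/- Let $A$ be a separable $C^*$-algebra, not necessarily unital, regarded as a Hilbert module over itself with right multiplication as action and inner product $\langle a,b\rangle=a^*b$. Let $K$ be an essential closed two-sided ideal of $A$ (essential means: if $a\in A$ and $aK=0$, then $a=0$). For a densely defined linear operator $T:D(T)\subseteq A\to A$, the adjoint $T^*$ has as domain the set of all $y\in A$ for which there is a (necessarily unique) $z\in A$ with $\langle Tx,y\rangle=\langle x,z\rangle$ for all $x\in D(T)$, and $T^*y=z$. The operator $T$ is called *semiregular* if $D(T)$ is dense in $A$ with $D(T)A\subseteq D(T)$, $T$ is closable, and $D(T^*)$ is dense. It is called *regular* if $T$ is closed, $D(T)$ is dense with $D(T)A\subseteq D(T)$, $D(T^*)$ is dense, and the range of $I+T^*T$ is dense. The same definitions apply to operators on the $C^*$-algebra $K$. Let $S$ be a closed semiregular operator on $A$. Then $S$ maps $D(S)\cap K$ into $K$; let $S|_K$ denote the operator on $K$ with domain $D(S)\cap K$ given by $S$. If $S|_K$ is regular as an operator on $K$ and $A/K$ is abelian, then $S^{**}=(S^*)^*$ is a regular operator on $A$. -/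

import Mathlib

/-! Unbounded operators on a C⋆-algebra `B`, where `B` is regarded as a Hilbert module over itself:
the right action is right multiplication and the `B`-valued inner product is `⟨a, b⟩ = a⋆ b`.
An operator is a `ℂ`-linear map defined on a linear subspace of `B`, i.e. a `LinearPMap`. -/

namespace CStarOperator

noncomputable section

/-- The set of pairs `(y, z)` such that `⟨T x, y⟩ = ⟨x, z⟩` for all `x ∈ D(T)`. -/
def adjointGraph {B : Type*} [NonUnitalCStarAlgebra B] (T : B →ₗ.[ℂ] B) : Submodule ℂ (B × B) where
  carrier := {p | ∀ x : T.domain, star (T x) * p.1 = star (x : B) * p.2}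
  add_mem' {p q} hp hq x := by
    simp only [Prod.fst_add, Prod.snd_add, mul_add, hp x, hq x]
  zero_mem' x := by simp
  smul_mem' c p hp x := by
    simp only [Prod.smul_fst, Prod.smul_snd, mul_smul_comm, hp x]

/-- The adjoint `T⋆`: its domain consists of all `y` for which there is a `z` with
`⟨T x, y⟩ = ⟨x, z⟩` for all `x ∈ D(T)`, and `T⋆ y = z`. When `D(T)` is dense this `z` is unique
(see `adjoint_graph`); for a non-dense domain the value is junk, and is never used below. -/
def adjoint {B : Type*} [NonUnitalCStarAlgebra B] (T : B →ₗ.[ℂ] B) : B →ₗ.[ℂ] B :=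
  (adjointGraph T).toLinearPMap

/-- For densely defined `T`, the graph of `T⋆` is the expected one. -/
theorem adjoint_graph {B : Type*} [NonUnitalCStarAlgebra B] (T : B →ₗ.[ℂ] B)
    (hT : Dense (T.domain : Set B)) : (adjoint T).graph = adjointGraph T := by
  refine Submodule.toLinearPMap_graph_eq _ ?_
  rintro ⟨y, z⟩ hp (rfl : y = 0)
  have h : ∀ x : B, star x * z = 0 := by
    intro x
    refine hT.induction (P := fun x => star x * z = 0) ?_ ?_ x
    · intro x hx
      simpa using (hp ⟨x, hx⟩).symm
    · exact isClosed_eq (by fun_prop) continuous_const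
  exact CStarRing.star_mul_self_eq_zero_iff z |>.mp (h z)

/-- `T` is semiregular: its domain is a dense right submodule, it is closable, and its adjoint is
densely defined. -/
structure IsSemiregular {B : Type*} [NonUnitalCStarAlgebra B] (T : B →ₗ.[ℂ] B) : Prop where
  dense_domain : Dense (T.domain : Set B)
  mul_mem_domain : ∀ x ∈ T.domain, ∀ b : B, x * b ∈ T.domain
  isClosable : T.IsClosable
  dense_adjoint_domain : Dense ((adjoint T).domain : Set B)

/-- The range of `I + T⋆T`, whose domain is `{x ∈ D(T) | T x ∈ D(T⋆)}`. -/
def rangeOneAddAdjointMul {B : Type*} [NonUnitalCStarAlgebra B] (T : B →ₗ.[ℂ] B) : Set B :=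
  {w | ∃ (x : T.domain) (y : (adjoint T).domain), (y : B) = T x ∧ w = (x : B) + adjoint T y}

/-- `T` is regular: it is closed, its domain is a dense right submodule, its adjoint is densely
defined, and `I + T⋆T` has dense range. -/
structure IsRegular {B : Type*} [NonUnitalCStarAlgebra B] (T : B →ₗ.[ℂ] B) : Prop where
  isClosed : T.IsClosed
  dense_domain : Dense (T.domain : Set B)
  mul_mem_domain : ∀ x ∈ T.domain, ∀ b : B, x * b ∈ T.domain
  dense_adjoint_domain : Dense ((adjoint T).domain : Set B)
  dense_range : Dense (rangeOneAddAdjointMul T)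

/-- `K` is a two-sided ideal. (Closed two-sided ideals of a C⋆-algebra are automatically linear
subspaces stable under `star`, so taking `K` to be a closed star-subalgebra loses nothing.) -/
structure IsTwoSidedIdeal {A : Type*} [NonUnitalCStarAlgebra A]
    (K : NonUnitalStarSubalgebra ℂ A) : Prop where
  mul_mem_left : ∀ (a : A), ∀ k ∈ K, a * k ∈ K
  mul_mem_right : ∀ (a : A), ∀ k ∈ K, k * a ∈ K

/-- The ideal `K` is essential: only `0` annihilates it. -/
def IsEssential {A : Type*} [NonUnitalCStarAlgebra A] (K : NonUnitalStarSubalgebra ℂ A) : Prop :=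
  ∀ a : A, (∀ k ∈ K, a * k = 0) → a = 0

/-- The ideal `K` as an object of Mathlib's type of two-sided ideals. -/
def IsTwoSidedIdeal.toTwoSidedIdeal {A : Type*} [NonUnitalCStarAlgebra A]
    {K : NonUnitalStarSubalgebra ℂ A} (hK : IsTwoSidedIdeal K) : TwoSidedIdeal A :=
  TwoSidedIdeal.mk' (K : Set A) (zero_mem K) (fun hx hy => add_mem hx hy) (fun hx => neg_mem hx)
    (fun {x y} hy => hK.mul_mem_left x y hy) (fun {x y} hx => hK.mul_mem_right y x hx)

/-- The quotient algebra `A / K`. -/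
abbrev IsTwoSidedIdeal.Quotient {A : Type*} [NonUnitalCStarAlgebra A]
    {K : NonUnitalStarSubalgebra ℂ A} (hK : IsTwoSidedIdeal K) : Type _ :=
  hK.toTwoSidedIdeal.ringCon.Quotient

/-- The restriction `S|_K` as an operator on `K`: `k ↦ S k` for those `k ∈ D(S) ∩ K` with
`S k ∈ K`. The last condition is automatic if `S` is semiregular and `K` is a closed ideal, see
`apply_mem_of_mem`. -/
def restrict {A : Type*} [NonUnitalCStarAlgebra A] (S : A →ₗ.[ℂ] A)
    (K : NonUnitalStarSubalgebra ℂ A) : K →ₗ.[ℂ] K where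
  domain :=
    { carrier := {k | ∃ h : (k : A) ∈ S.domain, S ⟨k, h⟩ ∈ K}
      add_mem' := by
        rintro k l ⟨hk, hk'⟩ ⟨hl, hl'⟩
        refine ⟨S.domain.add_mem hk hl, ?_⟩
        have := S.map_add ⟨k, hk⟩ ⟨l, hl⟩
        exact this ▸ add_mem hk' hl'
      zero_mem' := ⟨S.domain.zero_mem, by
        have := S.map_zero
        exact this ▸ zero_mem K⟩
      smul_mem' := by
        rintro c k ⟨hk, hk'⟩
        refine ⟨S.domain.smul_mem c hk, ?_⟩
        have := S.map_smul c ⟨k, hk⟩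
        exact this ▸ SMulMemClass.smul_mem c hk' }
  toFun :=
    { toFun := fun k => ⟨S ⟨((k : K) : A), k.2.choose⟩, k.2.choose_spec⟩
      map_add' := fun k l => Subtype.ext
        (S.map_add ⟨((k : K) : A), k.2.choose⟩ ⟨((l : K) : A), l.2.choose⟩)
      map_smul' := fun c k => Subtype.ext (S.map_smul c ⟨((k : K) : A), k.2.choose⟩) }

/-- A semiregular operator maps `D(S) ∩ K` into the closed ideal `K`, so `D(S|_K) = D(S) ∩ K`. -/
theorem apply_mem_of_mem {A : Type*} [NonUnitalCStarAlgebra A] {S : A →ₗ.[ℂ] A}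
    (hS : IsSemiregular S) {K : NonUnitalStarSubalgebra ℂ A} [hc : IsClosed (K : Set A)]
    (hK : IsTwoSidedIdeal K) (x : S.domain) (hx : (x : A) ∈ K) : S x ∈ K := by
  have h : ∀ b : A, star b * S x ∈ K := by
    intro b
    refine hS.dense_adjoint_domain.induction (P := fun b => star b * S x ∈ K) ?_ ?_ b
    · intro y hy
      have hg : (y, adjoint S ⟨y, hy⟩) ∈ adjointGraph S := by
        rw [← adjoint_graph S hS.dense_domain]
        exact LinearPMap.mem_graph _ ⟨y, hy⟩
      have h1 : star (S x) * y = star (x : A) * adjoint S ⟨y, hy⟩ := hg x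
      have h2 := congrArg star h1
      simp only [star_mul, star_star] at h2
      rw [h2]
      exact hK.mul_mem_left _ _ hx
    · exact hc.preimage (f := fun b => star b * S x) (by fun_prop)
  let _ := CStarAlgebra.spectralOrder A
  have _ := CStarAlgebra.spectralOrderedRing A
  have ht := (CStarAlgebra.increasingApproximateUnit A).tendsto_mul_right (S x)
  refine hc.mem_of_tendsto ht (Filter.Eventually.of_forall fun e => ?_)
  simpa using h (star e)

end

end CStarOperator

/-!
The inner product of `B × B` is `⟨g, h⟩ = g.1⋆ h.1 + g.2⋆ h.2`, and the orthogonal complement of the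
graph `G(S)` is the rotated graph `V G(S⋆)` of the adjoint, where `V (y, z) = (-z, y)`. If `S` is
closed, both are closed, and orthogonality forces their sum `W` to be closed too
(`isClosed_graphSup`). A decomposition `(a, 0) = (x, S x) + V (y, S⋆ y)` amounts to
`a = x + S⋆ S x`, so `S⋆⋆` is regular as soon as `(a, 0) ∈ W` for all `a`
(`isRegular_adjoint_adjoint`); in fact `1 + S⋆ S` is then already surjective.

Since `K` is essential, the adjoint of `S|_K` is contained in `S⋆` (`mem_adjointGraph_of_restrict`).
Density of the range of `1 + (S|_K)⋆ S|_K` and closedness of `W` therefore give `K × 0 ⊆ W`, and then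
density of the domain of `(S|_K)⋆` gives `0 × K ⊆ W`.

It remains to see that the closed right ideal `J = {a | (a, 0) ∈ W}`, which contains `K`, is
everything. For `x ∈ D(S)` and `y ∈ D(S⋆)` put `u = S x` and `v = S⋆ y`. Then
`(x, u) y + (-v, y) (-u) = (x y + v u, u y - y u)` lies in `W`, and its second entry lies in `K`
because `A / K` is commutative, so `x y + v u ∈ J`. Multiplying by `x⋆`, commuting modulo `K` and
using `x⋆ v = u⋆ y` gives `(x⋆ x + u⋆ u) y ∈ J`, hence `x⋆ x + u⋆ u ∈ J` as `D(S⋆)` is dense.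
Closed right ideals are hereditary (`star_mem_of_star_mul_self_add_mem`), so `x⋆ ∈ J`; as `D(S)` is
dense, `J = A`.
-/

namespace CStarOperator

open Filter Topology

/-! ### Closed right ideals are hereditary -/

section Hereditary

variable {A : Type*} [NonUnitalCStarAlgebra A]

/-- A continuous `φ` vanishing at `0` such that `t (1 - φ(t) t)²` is uniformly small. The square is
expanded so that the functional calculus can be applied without a unit. -/
theorem exists_continuous_abs_cutoff_le {δ : ℝ} (hδ : 0 < δ) :
    ∃ φ : ℝ → ℝ, Continuous φ ∧ φ 0 = 0 ∧
      ∀ t, |t - φ t * t * t - t * (φ t * t) + φ t * t * t * (φ t * t)| ≤ δ := by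
  have hpos : ∀ t : ℝ, 0 < δ ^ 2 + t ^ 2 := fun t => by positivity
  refine ⟨fun t => t / (δ ^ 2 + t ^ 2), ?_, by simp, fun t => ?_⟩
  · exact continuous_id.div (by fun_prop) fun t => (hpos t).ne'
  have hp := hpos t
  have : t - t / (δ ^ 2 + t ^ 2) * t * t - t * (t / (δ ^ 2 + t ^ 2) * t)
      + t / (δ ^ 2 + t ^ 2) * t * t * (t / (δ ^ 2 + t ^ 2) * t)
      = (t * δ) * (δ * δ ^ 2) / (δ ^ 2 + t ^ 2) ^ 2 := by
    field_simp; ring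
  rw [this, abs_div, abs_of_pos (by positivity : 0 < (δ ^ 2 + t ^ 2) ^ 2),
    div_le_iff₀ (by positivity), abs_mul, abs_of_pos (by positivity : 0 < δ * δ ^ 2)]
  have h1 : |t * δ| ≤ δ ^ 2 + t ^ 2 := by
    rw [abs_le]; constructor <;> nlinarith [sq_nonneg (t + δ), sq_nonneg (t - δ)]
  calc |t * δ| * (δ * δ ^ 2) ≤ (δ ^ 2 + t ^ 2) * (δ * (δ ^ 2 + t ^ 2)) := by
        gcongr; nlinarith [sq_nonneg t]
    _ = _ := by ring

/-- With `f = g h`, the element whose norm is estimated is `(1 - f) h (1 - f)`, written without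
the unit. -/
theorem exists_isSelfAdjoint_norm_cutoff_le {h : A} (hsa : IsSelfAdjoint h) {δ : ℝ}
    (hδ : 0 < δ) : ∃ g : A, IsSelfAdjoint (g * h) ∧
      ‖h - g * h * h - h * (g * h) + g * h * h * (g * h)‖ ≤ δ := by
  obtain ⟨φ, hφ, hφ0, hφδ⟩ := exists_continuous_abs_cutoff_le hδ
  have hψ : Continuous fun t => φ t * t := hφ.mul continuous_id
  have hχ : Continuous fun t => φ t * t * t := hψ.mul continuous_id
  have hχ' : Continuous fun t => t * (φ t * t) := continuous_id.mul hψ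
  have hω : Continuous fun t => φ t * t * t * (φ t * t) := hχ.mul hψ
  have hid : cfcₙ (fun t : ℝ => t) h = h := cfcₙ_id' ℝ h
  have h0 : cfcₙ φ h * h = cfcₙ (fun t => φ t * t) h := by
    rw [cfcₙ_mul φ (fun t => t) h hφ.continuousOn hφ0 continuousOn_id rfl, hid]
  have h1 : cfcₙ φ h * h * h = cfcₙ (fun t => φ t * t * t) h := by
    rw [cfcₙ_mul (fun t => φ t * t) (fun t => t) h hψ.continuousOn (mul_zero _)
      continuousOn_id rfl, hid, h0]
  have h2 : h * (cfcₙ φ h * h) = cfcₙ (fun t => t * (φ t * t)) h := by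
    rw [cfcₙ_mul (fun t => t) (fun t => φ t * t) h continuousOn_id rfl
      hψ.continuousOn (mul_zero _), hid, h0]
  have h3 : cfcₙ φ h * h * h * (cfcₙ φ h * h) = cfcₙ (fun t => φ t * t * t * (φ t * t)) h := by
    rw [cfcₙ_mul (fun t => φ t * t * t) (fun t => φ t * t) h hχ.continuousOn (mul_zero _)
      hψ.continuousOn (mul_zero _), h1, h0]
  refine ⟨cfcₙ φ h, h0 ▸ cfcₙ_predicate _ h, ?_⟩
  rw [h3, h1, h2]
  nth_rw 1 [← hid]
  rw [← cfcₙ_sub (fun t => t) _ h continuousOn_id rfl hχ.continuousOn (mul_zero _),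
    ← cfcₙ_sub (fun t => t - φ t * t * t) _ h (continuous_id.sub hχ).continuousOn (by simp)
      hχ'.continuousOn (zero_mul _),
    ← cfcₙ_add (fun t => t - φ t * t * t - t * (φ t * t)) _ h
      ((continuous_id.sub hχ).sub hχ').continuousOn (by simp) hω.continuousOn (by simp)]
  exact norm_cfcₙ_le fun t _ => hφδ t

/-- The element `x` is approximated by left multiples of `x⋆ x + u⋆ u`: with `f = g (x⋆ x + u⋆ u)`
self-adjoint, `|x - x f|² ≤ |x - x f|² + |u - u f|² = (1 - f) (x⋆ x + u⋆ u) (1 - f)`. -/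
theorem exists_norm_sub_mul_mul_le (x u : A) {δ : ℝ} (hδ : 0 < δ) :
    ∃ g : A, ‖x - x * (g * (star x * x + star u * u))‖ ^ 2 ≤ δ := by
  let _ := CStarAlgebra.spectralOrder A
  have _ := CStarAlgebra.spectralOrderedRing A
  have hsa : IsSelfAdjoint (star x * x + star u * u) := by
    simp [isSelfAdjoint_iff]
  obtain ⟨g, hg, hgδ⟩ := exists_isSelfAdjoint_norm_cutoff_le hsa hδ
  refine ⟨g, ?_⟩
  set f := g * (star x * x + star u * u)
  have hsum : star (x - x * f) * (x - x * f) + star (u - u * f) * (u - u * f)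
      = (star x * x + star u * u) - f * (star x * x + star u * u)
        - (star x * x + star u * u) * f + f * (star x * x + star u * u) * f := by
    simp only [star_sub, star_mul, hg.star_eq]
    noncomm_ring
  have hle : star (x - x * f) * (x - x * f)
      ≤ star (x - x * f) * (x - x * f) + star (u - u * f) * (u - u * f) :=
    le_add_of_nonneg_right (star_mul_self_nonneg _)
  calc ‖x - x * f‖ ^ 2 = ‖star (x - x * f) * (x - x * f)‖ := by
        rw [CStarRing.norm_star_mul_self, sq]
    _ ≤ _ := CStarAlgebra.norm_le_norm_of_nonneg_of_le (star_mul_self_nonneg _) hle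
    _ ≤ δ := hsum ▸ hgδ

/-- Heredity of closed right ideals, for the inequality `x⋆ x ≤ x⋆ x + u⋆ u`. -/
theorem star_mem_of_star_mul_self_add_mem {J : Submodule ℂ A} (hJ : IsClosed (J : Set A))
    (hJr : ∀ a ∈ J, ∀ b : A, a * b ∈ J) {x u : A} (h : star x * x + star u * u ∈ J) :
    star x ∈ J := by
  rw [← SetLike.mem_coe, ← hJ.closure_eq, Metric.mem_closure_iff]
  intro ε hε
  obtain ⟨g, hg⟩ := exists_norm_sub_mul_mul_le x u (δ := ε ^ 2 / 4) (by positivity)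
  refine ⟨_, hJr _ h (star g * star x), ?_⟩
  have : star x - (star x * x + star u * u) * (star g * star x)
      = star (x - x * (g * (star x * x + star u * u))) := by
    simp [mul_assoc]
  rw [dist_eq_norm, this, norm_star]
  nlinarith [norm_nonneg (x - x * (g * (star x * x + star u * u)))]

end Hereditary

/-! ### The graph of an operator and its orthogonal complement -/

section Graph

variable {B : Type*} [NonUnitalCStarAlgebra B]

theorem mem_adjointGraph_iff {T : B →ₗ.[ℂ] B} {p : B × B} :
    p ∈ adjointGraph T ↔ ∀ q ∈ T.graph, star q.2 * p.1 = star q.1 * p.2 := by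
  constructor
  · rintro h ⟨x, y⟩ hq
    obtain ⟨x, rfl, rfl⟩ := (LinearPMap.mem_graph_iff _).mp hq
    exact h x
  · exact fun h x => h _ (T.mem_graph x)

theorem isClosed_adjointGraph (T : B →ₗ.[ℂ] B) : IsClosed (adjointGraph T : Set (B × B)) := by
  have : (adjointGraph T : Set (B × B))
      = ⋂ x : T.domain, {p | star (T x) * p.1 = star (x : B) * p.2} := by
    ext p; simp only [Set.mem_iInter]; rfl
  rw [this]
  exact isClosed_iInter fun x => isClosed_eq (by fun_prop) (by fun_prop)

theorem mul_mem_adjointGraph {T : B →ₗ.[ℂ] B} {p : B × B} (hp : p ∈ adjointGraph T) (b : B) :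
    (p.1 * b, p.2 * b) ∈ adjointGraph T := fun x => by
  simp only [← mul_assoc, hp x]

theorem eq_of_forall_dense_star_mul {s : Set B} (hs : Dense s) {a b : B}
    (h : ∀ y ∈ s, star a * y = star b * y) : a = b := by
  have h' : ∀ y : B, star (a - b) * y = 0 := fun y =>
    hs.induction (P := fun y => star (a - b) * y = 0)
      (fun y hy => by rw [star_sub, sub_mul, h y hy, sub_self])
      (isClosed_eq (by fun_prop) continuous_const) y
  exact sub_eq_zero.mp ((CStarRing.star_mul_self_eq_zero_iff _).mp (h' _))

/-- Semiregular operators are right `B`-linear; this is forced by the density of `D(T⋆)`. -/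
theorem IsSemiregular.mul_mem_graph {T : B →ₗ.[ℂ] B} (hT : IsSemiregular T) {p : B × B}
    (hp : p ∈ T.graph) (b : B) : (p.1 * b, p.2 * b) ∈ T.graph := by
  obtain ⟨x, y⟩ := p
  obtain ⟨x, rfl, rfl⟩ := LinearPMap.mem_graph_iff _ |>.mp hp
  refine (LinearPMap.mem_graph_iff _).mpr ⟨⟨x * b, hT.mul_mem_domain x x.2 b⟩, rfl, ?_⟩
  refine eq_of_forall_dense_star_mul hT.dense_adjoint_domain fun y hy => ?_
  have hg : (y, adjoint T ⟨y, hy⟩) ∈ adjointGraph T := by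
    rw [← adjoint_graph T hT.dense_domain]
    exact LinearPMap.mem_graph _ ⟨y, hy⟩
  have h1 := hg ⟨x * b, hT.mul_mem_domain x x.2 b⟩
  have h2 := hg x
  simp only at h1 h2
  rw [h1, star_mul, star_mul, mul_assoc, mul_assoc, h2]

/-- The set `{(-z, y) | (y, z) ∈ G(T⋆)}`, which is the orthogonal complement of the graph of `T` in
`B × B`. -/
def adjointGraphRotated (T : B →ₗ.[ℂ] B) : Submodule ℂ (B × B) :=
  (adjointGraph T).map
    ((LinearMap.prod (-LinearMap.snd ℂ B B) (LinearMap.fst ℂ B B)) : (B × B) →ₗ[ℂ] (B × B))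

theorem mem_adjointGraphRotated {T : B →ₗ.[ℂ] B} {p : B × B} :
    p ∈ adjointGraphRotated T ↔ (p.2, -p.1) ∈ adjointGraph T := by
  rw [adjointGraphRotated, Submodule.mem_map]
  constructor
  · rintro ⟨q, hq, rfl⟩
    simpa using hq
  · intro h
    exact ⟨_, h, by simp⟩

theorem isClosed_adjointGraphRotated (T : B →ₗ.[ℂ] B) :
    IsClosed (adjointGraphRotated T : Set (B × B)) := by
  have : (adjointGraphRotated T : Set (B × B))
      = (fun p : B × B => (p.2, -p.1)) ⁻¹' (adjointGraph T) := by
    ext p; exact mem_adjointGraphRotated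
  rw [this]
  exact (isClosed_adjointGraph T).preimage (by fun_prop)

/-- If `g` and `h` are orthogonal in `B × B`, then `⟨g, g⟩ ≤ ⟨g + h, g + h⟩`. The constant `2` leaves
room for the sup norm of `B × B`, which is only equivalent to the Hilbert module norm. -/
theorem norm_le_two_mul_norm_add {g h : B × B}
    (horth : star g.1 * h.1 + star g.2 * h.2 = 0) : ‖g‖ ≤ 2 * ‖g + h‖ := by
  let _ := CStarAlgebra.spectralOrder B
  have _ := CStarAlgebra.spectralOrderedRing B
  have horth' : star h.1 * g.1 + star h.2 * g.2 = 0 := by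
    simpa using congrArg star horth
  have key : star (g + h).1 * (g + h).1 + star (g + h).2 * (g + h).2
      = star g.1 * g.1 + star g.2 * g.2 + (star h.1 * h.1 + star h.2 * h.2) := by
    calc _ = star g.1 * g.1 + star g.2 * g.2 + (star h.1 * h.1 + star h.2 * h.2)
          + (star g.1 * h.1 + star g.2 * h.2) + (star h.1 * g.1 + star h.2 * g.2) := by
            simp only [Prod.fst_add, Prod.snd_add, star_add]; noncomm_ring
      _ = _ := by rw [horth, horth', add_zero, add_zero]
  have hbound : ∀ c : B, 0 ≤ star c * c →
      star c * c ≤ star (g + h).1 * (g + h).1 + star (g + h).2 * (g + h).2 →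
      ‖c‖ ≤ 2 * ‖g + h‖ := by
    intro c hc0 hc
    have h1 := CStarAlgebra.norm_le_norm_of_nonneg_of_le hc0 hc
    have h2 := h1.trans (norm_add_le _ _)
    rw [CStarRing.norm_star_mul_self, CStarRing.norm_star_mul_self,
      CStarRing.norm_star_mul_self] at h2
    have h3 := norm_fst_le (g + h)
    have h4 := norm_snd_le (g + h)
    have h5 := norm_nonneg (g + h).1
    have h6 := norm_nonneg (g + h).2
    nlinarith [norm_nonneg c]
  have n1 := star_mul_self_nonneg g.1
  have n2 := star_mul_self_nonneg g.2
  have n3 := add_nonneg (star_mul_self_nonneg h.1) (star_mul_self_nonneg h.2)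
  rw [key] at hbound
  refine norm_prod_le_iff.mpr ⟨hbound _ n1 ?_, hbound _ n2 ?_⟩
  · rw [add_assoc]; exact le_add_of_nonneg_right (add_nonneg n2 n3)
  · rw [add_comm (star g.1 * g.1), add_assoc]; exact le_add_of_nonneg_right (add_nonneg n1 n3)

theorem isClosed_sup_of_norm_le {E : Type*} [NormedAddCommGroup E]
    [NormedSpace ℂ E] [CompleteSpace E] {M N : Submodule ℂ E} (hM : IsClosed (M : Set E))
    (hN : IsClosed (N : Set E)) (C : NNReal) (h : ∀ m ∈ M, ∀ n ∈ N, ‖m‖ ≤ C * ‖m + n‖) :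
    IsClosed ((M ⊔ N : Submodule ℂ E) : Set E) := by
  have := hM.completeSpace_coe
  have := hN.completeSpace_coe
  let φ : (M × N) →L[ℂ] E := M.subtypeL.coprod N.subtypeL
  have hφ : AntilipschitzWith (C + 1) φ := by
    refine φ.antilipschitz_of_bound fun p => ?_
    have h1 := h p.1 p.1.2 p.2 p.2.2
    have h2 : ‖(p.2 : E)‖ ≤ ‖(p.1 : E) + p.2‖ + ‖(p.1 : E)‖ := by
      simpa using norm_sub_le ((p.1 : E) + p.2) (p.1 : E)
    refine norm_prod_le_iff.mpr ⟨?_, ?_⟩ <;>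
      simp only [φ, ContinuousLinearMap.coprod_apply, Submodule.subtypeL_apply, Submodule.coe_norm,
        NNReal.coe_add, NNReal.coe_one] <;>
      nlinarith [norm_nonneg ((p.1 : E) + p.2)]
  have hr : ((M ⊔ N : Submodule ℂ E) : Set E) = Set.range φ := by
    ext z
    simp [φ, Submodule.mem_sup]
  rw [hr]
  exact hφ.isClosed_range φ.uniformContinuous

/-- The algebraic sum of the graph of `T` and its orthogonal complement. -/
def graphSup (T : B →ₗ.[ℂ] B) : Submodule ℂ (B × B) := T.graph ⊔ adjointGraphRotated T

theorem isClosed_graphSup {T : B →ₗ.[ℂ] B} (hT : T.IsClosed) :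
    IsClosed (graphSup T : Set (B × B)) := by
  refine isClosed_sup_of_norm_le hT (isClosed_adjointGraphRotated T) 2 ?_
  intro g hg h hh
  refine norm_le_two_mul_norm_add ?_
  have := mem_adjointGraph_iff.mp (mem_adjointGraphRotated.mp hh) g hg
  simp only at this
  rw [this, mul_neg, add_neg_cancel]

theorem IsSemiregular.mul_mem_graphSup {T : B →ₗ.[ℂ] B} (hT : IsSemiregular T) {p : B × B}
    (hp : p ∈ graphSup T) (b : B) : (p.1 * b, p.2 * b) ∈ graphSup T := by
  obtain ⟨g, hg, h, hh, rfl⟩ := Submodule.mem_sup.mp hp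
  refine Submodule.mem_sup.mpr ⟨_, hT.mul_mem_graph hg b, (h.1 * b, h.2 * b), ?_, ?_⟩
  · have := mul_mem_adjointGraph (mem_adjointGraphRotated.mp hh) b
    exact mem_adjointGraphRotated.mpr (by simpa using this)
  · simp [add_mul]

theorem mem_rangeOneAddAdjointMul {T : B →ₗ.[ℂ] B} {x y z : B} (h1 : (x, y) ∈ T.graph)
    (h2 : (y, z) ∈ (adjoint T).graph) : x + z ∈ rangeOneAddAdjointMul T := by
  obtain ⟨x, rfl, rfl⟩ := LinearPMap.mem_graph_iff _ |>.mp h1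
  obtain ⟨y, hy, rfl⟩ := LinearPMap.mem_graph_iff _ |>.mp h2
  exact ⟨x, y, hy, rfl⟩

theorem exists_of_mem_rangeOneAddAdjointMul {T : B →ₗ.[ℂ] B} (hT : Dense (T.domain : Set B))
    {w : B} (h : w ∈ rangeOneAddAdjointMul T) :
    ∃ x y z, (x, y) ∈ T.graph ∧ (y, z) ∈ adjointGraph T ∧ w = x + z := by
  obtain ⟨x, y, hy, rfl⟩ := h
  exact ⟨x, T x, adjoint T y, T.mem_graph x,
    adjoint_graph T hT ▸ hy ▸ (adjoint T).mem_graph y, rfl⟩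

theorem exists_of_mk_zero_mem_graphSup {T : B →ₗ.[ℂ] B} {a : B} (h : (a, 0) ∈ graphSup T) :
    ∃ x y z, (x, y) ∈ T.graph ∧ (y, z) ∈ adjointGraph T ∧ a = x + z := by
  obtain ⟨⟨x, y⟩, hg, ⟨z, v⟩, hh, he⟩ := Submodule.mem_sup.mp h
  obtain ⟨h1, h2⟩ := Prod.mk.inj he
  have h3 : v = -y := (neg_eq_of_add_eq_zero_right h2).symm
  have h4 := mem_adjointGraphRotated.mp hh
  refine ⟨x, y, z, hg, ?_, h1.symm⟩
  subst h3
  simpa using (adjointGraph T).neg_mem h4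

/-- A pair `(a, 0)` in the sum of `G(S)` and its complement gives `a = x + S⋆ S x`, so by hypothesis
`1 + S⋆ S` is surjective; this passes to `S⋆⋆` because `S ⊆ S⋆⋆` and `S⋆ ⊆ S⋆⋆⋆`. -/
theorem isRegular_adjoint_adjoint {S : B →ₗ.[ℂ] B} (hS : IsSemiregular S)
    (h : ∀ a : B, (a, 0) ∈ graphSup S) : IsRegular (adjoint (adjoint S)) := by
  have hg1 := adjoint_graph S hS.dense_domain
  have hg2 := adjoint_graph (adjoint S) hS.dense_adjoint_domain
  have hle : S.graph ≤ (adjoint (adjoint S)).graph := by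
    rw [hg2]
    intro p hp
    rw [mem_adjointGraph_iff, hg1]
    intro q hq
    simpa using congrArg star (mem_adjointGraph_iff.mp hq p hp).symm
  have hdom : ∀ x ∈ S.domain, x ∈ (adjoint (adjoint S)).domain := fun x hx =>
    LinearPMap.mem_domain_of_mem_graph (hle (S.mem_graph ⟨x, hx⟩))
  have hd2 : Dense ((adjoint (adjoint S)).domain : Set B) := hS.dense_domain.mono hdom
  have hg3 := adjoint_graph (adjoint (adjoint S)) hd2
  have hle' : (adjoint S).graph ≤ (adjoint (adjoint (adjoint S))).graph := by
    rw [hg3]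
    intro p hp
    rw [mem_adjointGraph_iff, hg2]
    intro q hq
    simpa using congrArg star (mem_adjointGraph_iff.mp hq p hp).symm
  refine ⟨?_, hd2, ?_, ?_, ?_⟩
  · rw [LinearPMap.IsClosed, hg2]
    exact isClosed_adjointGraph _
  · intro x hx b
    have := mul_mem_adjointGraph (hg2 ▸ (adjoint (adjoint S)).mem_graph ⟨x, hx⟩) b
    rw [← hg2] at this
    exact LinearPMap.mem_domain_of_mem_graph this
  · exact hS.dense_adjoint_domain.mono fun x hx =>
      LinearPMap.mem_domain_of_mem_graph (hle' ((adjoint S).mem_graph ⟨x, hx⟩))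
  · intro a
    obtain ⟨x, y, z, hxy, hyz, rfl⟩ := exists_of_mk_zero_mem_graphSup (h a)
    exact subset_closure (mem_rangeOneAddAdjointMul (hle hxy) (hle' (hg1 ▸ hyz)))

end Graph

/-! ### Restriction to an essential ideal with commutative quotient -/

section Ideal

variable {A : Type*} [NonUnitalCStarAlgebra A] {K : NonUnitalStarSubalgebra ℂ A}

theorem mem_graph_restrict {S : A →ₗ.[ℂ] A} {k l : K} :
    (k, l) ∈ (restrict S K).graph ↔ ((k : A), (l : A)) ∈ S.graph := by
  simp only [LinearPMap.mem_graph_iff]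
  constructor
  · rintro ⟨x, rfl, rfl⟩
    exact ⟨⟨_, x.2.choose⟩, rfl, rfl⟩
  · rintro ⟨⟨x, hx⟩, rfl, hy⟩
    exact ⟨⟨k, hx, by rw [hy]; exact l.2⟩, rfl, Subtype.ext hy⟩

variable [IsClosed (K : Set A)]

/-- For an essential ideal `K`, the adjoint of `S|_K` is contained in the adjoint of `S`: for
`x ∈ D(S)` the required identity holds after multiplication by every `k ∈ K`, since
`x k ∈ D(S) ∩ K`. -/
theorem mem_adjointGraph_of_restrict (hK : IsTwoSidedIdeal K) (hess : IsEssential K)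
    {S : A →ₗ.[ℂ] A} (hS : IsSemiregular S) {y z : K}
    (h : (y, z) ∈ adjointGraph (restrict S K)) : ((y : A), (z : A)) ∈ adjointGraph S := by
  intro x
  refine sub_eq_zero.mp (star_eq_zero.mp (hess _ fun k hk => ?_))
  have hxk := hS.mul_mem_graph (S.mem_graph x) k
  have hres : ((⟨x * k, hK.mul_mem_left _ k hk⟩ : K), (⟨S x * k, hK.mul_mem_left _ k hk⟩ : K))
      ∈ (restrict S K).graph := mem_graph_restrict.mpr hxk
  have h1 := congrArg (fun t : K => star (t : A)) (mem_adjointGraph_iff.mp h _ hres)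
  simp only [NonUnitalStarSubalgebra.coe_mul, StarMemClass.coe_star, star_mul,
    star_star] at h1
  simp only [star_sub, star_mul, star_star, sub_mul, mul_assoc, sub_eq_zero]
  simpa [mul_assoc] using h1

theorem mk_zero_mem_graphSup (hK : IsTwoSidedIdeal K) (hess : IsEssential K)
    {S : A →ₗ.[ℂ] A} (hS : IsSemiregular S) (hSc : S.IsClosed) (hSK : IsRegular (restrict S K))
    (k : K) : ((k : A), (0 : A)) ∈ graphSup S := by
  refine hSK.dense_range.induction (P := fun k : K => ((k : A), (0 : A)) ∈ graphSup S) ?_ ?_ k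
  · intro k hk
    obtain ⟨x, y, z, hxy, hyz, rfl⟩ := exists_of_mem_rangeOneAddAdjointMul hSK.dense_domain hk
    refine Submodule.mem_sup.mpr ⟨(x, y), mem_graph_restrict.mp hxy, (z, -y), ?_, by simp⟩
    have := mem_adjointGraph_of_restrict hK hess hS hyz
    exact mem_adjointGraphRotated.mpr (by simpa using (adjointGraph S).neg_mem this)
  · exact (isClosed_graphSup hSc).preimage (f := fun k : K => ((k : A), (0 : A))) (by fun_prop)

/-- For `y` in the domain of `(S|_K)⋆`, the pair `(0, y)` is the sum of `(-S⋆ y, y)` and `(S⋆ y, 0)`,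
and the latter belongs to `K × 0`. -/
theorem zero_mk_mem_graphSup (hK : IsTwoSidedIdeal K) (hess : IsEssential K)
    {S : A →ₗ.[ℂ] A} (hS : IsSemiregular S) (hSc : S.IsClosed) (hSK : IsRegular (restrict S K))
    (k : K) : ((0 : A), (k : A)) ∈ graphSup S := by
  refine hSK.dense_adjoint_domain.induction
    (P := fun k : K => ((0 : A), (k : A)) ∈ graphSup S) ?_ ?_ k
  · intro y hy
    have hyz := (adjoint (restrict S K)).mem_graph ⟨y, hy⟩
    rw [adjoint_graph _ hSK.dense_domain] at hyz
    have h1 := mem_adjointGraph_of_restrict hK hess hS hyz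
    have h2 : (-(adjoint (restrict S K) ⟨y, hy⟩ : A), (y : A)) ∈ graphSup S :=
      Submodule.mem_sup_right (mem_adjointGraphRotated.mpr (by simpa using h1))
    simpa using add_mem h2 (mk_zero_mem_graphSup hK hess hS hSc hSK (adjoint (restrict S K) ⟨y, hy⟩))
  · exact (isClosed_graphSup hSc).preimage (f := fun k : K => ((0 : A), (k : A))) (by fun_prop)

omit [IsClosed (K : Set A)] in
theorem commutator_mem (hK : IsTwoSidedIdeal K) (hcomm : ∀ x y : hK.Quotient, x * y = y * x)
    (a b : A) : a * b - b * a ∈ K := by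
  have h : (((a * b : A) : hK.Quotient)) = ((b * a : A) : hK.Quotient) := hcomm a b
  rw [RingCon.eq, TwoSidedIdeal.rel_iff] at h
  exact (TwoSidedIdeal.mem_mk' ..).mp h

/-- If commutators lie in `K`, then `J = {a | (a, 0) ∈ graphSup S}` is the whole algebra. -/
theorem mk_zero_mem_graphSup_of_commutative_quotient (hK : IsTwoSidedIdeal K)
    (hess : IsEssential K) {S : A →ₗ.[ℂ] A} (hS : IsSemiregular S) (hSc : S.IsClosed)
    (hSK : IsRegular (restrict S K)) (hcomm : ∀ a b : A, a * b - b * a ∈ K) (a : A) :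
    (a, (0 : A)) ∈ graphSup S := by
  let J : Submodule ℂ A := (graphSup S).comap (LinearMap.inl ℂ A A)
  have hJ : ∀ a, a ∈ J ↔ (a, (0 : A)) ∈ graphSup S := fun a => Iff.rfl
  have hJc : IsClosed (J : Set A) :=
    (isClosed_graphSup hSc).preimage (f := fun a : A => (a, (0 : A))) (by fun_prop)
  have hJr : ∀ a ∈ J, ∀ b : A, a * b ∈ J := fun a ha b => by
    simpa [hJ] using hS.mul_mem_graphSup ha b
  have hKJ : ∀ k ∈ K, k ∈ J := fun k hk => mk_zero_mem_graphSup hK hess hS hSc hSK ⟨k, hk⟩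
  have fst_mem : ∀ x u y v : A, (x, u) ∈ S.graph → (y, v) ∈ adjointGraph S → x * y + v * u ∈ J := by
    intro x u y v hxu hyv
    -- `(x, u) y - (-v, y) u = (x y + v u, u y - y u)`, and the second entry lies in `K`
    have h1 := hS.mul_mem_graphSup (p := (x, u)) (Submodule.mem_sup_left hxu) y
    have h2 : (-v, y) ∈ graphSup S :=
      Submodule.mem_sup_right (mem_adjointGraphRotated.mpr (by simpa using hyv))
    have h3 := hS.mul_mem_graphSup h2 u
    have h4 := zero_mk_mem_graphSup hK hess hS hSc hSK ⟨_, hcomm u y⟩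
    have h5 := sub_mem (sub_mem h1 h3) h4
    rw [hJ]
    simpa using h5
  have abs_sq_mul_mem : ∀ x u y v : A, (x, u) ∈ S.graph → (y, v) ∈ adjointGraph S →
      (star x * x + star u * u) * y ∈ J := by
    intro x u y v hxu hyv
    have h0 : star u * y = star x * v := mem_adjointGraph_iff.mp hyv _ hxu
    have h1 := hJr _ (fst_mem x u y v hxu hyv) (star x)
    have e : (star x * x + star u * u) * y
        = (x * y + v * u) * star x + (star x * (x * y) - (x * y) * star x)
          + star u * (u * y - y * u)
          + (star x * (v * u) - (v * u) * star x) := by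
      calc _ = star x * (x * y) + star u * (u * y - y * u) + (star u * y) * u := by noncomm_ring
        _ = _ := by rw [h0]; noncomm_ring
    rw [e]
    exact add_mem (add_mem (add_mem h1 (hKJ _ (hcomm _ _)))
      (hKJ _ (hK.mul_mem_left _ _ (hcomm _ _)))) (hKJ _ (hcomm _ _))
  have star_mem : ∀ x u : A, (x, u) ∈ S.graph → star x ∈ J := by
    intro x u hxu
    have h1 : ∀ b : A, (star x * x + star u * u) * b ∈ J := fun b => by
      refine hS.dense_adjoint_domain.induction
        (P := fun b => (star x * x + star u * u) * b ∈ J) ?_ ?_ b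
      · intro y hy
        refine abs_sq_mul_mem x u y (adjoint S ⟨y, hy⟩) hxu ?_
        rw [← adjoint_graph S hS.dense_domain]
        exact LinearPMap.mem_graph _ ⟨y, hy⟩
      · exact hJc.preimage (f := fun b => (star x * x + star u * u) * b) (by fun_prop)
    let _ := CStarAlgebra.spectralOrder A
    have _ := CStarAlgebra.spectralOrderedRing A
    -- the factor `b` is removed with an approximate unit
    refine star_mem_of_star_mul_self_add_mem hJc hJr (x := x) (u := u) ?_
    exact hJc.mem_of_tendsto ((CStarAlgebra.increasingApproximateUnit A).tendsto_mul_left _)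
      (Eventually.of_forall h1)
  have h : star (star a) ∈ J := by
    refine hS.dense_domain.induction (P := fun x => star x ∈ J)
      (fun x hx => star_mem x _ (S.mem_graph ⟨x, hx⟩)) ?_ (star a)
    exact hJc.preimage continuous_star
  simpa [hJ] using h

end Ideal

end CStarOperator

theorem corollary3p2 {A : Type*} [NonUnitalCStarAlgebra A] [TopologicalSpace.SeparableSpace A]
    (K : NonUnitalStarSubalgebra ℂ A) [IsClosed (K : Set A)]
    (hK : CStarOperator.IsTwoSidedIdeal K) (hess : CStarOperator.IsEssential K)
    (S : A →ₗ.[ℂ] A) (hS : CStarOperator.IsSemiregular S) (hSclosed : S.IsClosed)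
    (hSK : CStarOperator.IsRegular (CStarOperator.restrict S K))
    (hcomm : ∀ x y : hK.Quotient, x * y = y * x) :
    CStarOperator.IsRegular (CStarOperator.adjoint (CStarOperator.adjoint S)) :=
  CStarOperator.isRegular_adjoint_adjoint hS
    (CStarOperator.mk_zero_mem_graphSup_of_commutative_quotient hK hess hS hSclosed hSK
      (CStarOperator.commutator_mem hK hcomm))
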